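/- **Setting.** Let $q>2$ and $N_r\ge 1$ be integers and let $r_1,\dots,r_{N_r}$ be an admissible family of scale values: distinct integers with $0<r_i<2q$, $\gcd(r_i,2q)=1$, and $r_i\not\equiv r_j(q+1) \pmod{2q}$ for $i\ne j$. An exponent chain of length 4 is a matrix $A=\begin{pmatrix}a&b\\c&d\end{pmatrix}$ with entries in $\{0,\dots,2q-1\}$. Such a matrix of nonnegative integers forms a cycle for the circulant size $L$ if the Tanner graph of the parity-check matrix $\begin{pmatrix}P^a&P^b\\P^c&P^d\end{pmatrix}$ contains a cycle of length 4, where $P$ is the $L\times L$ circulant permutation matrix with $P_{ij}=1$ iff $i+1\equiv j \pmod L$ (equivalently, if $a-b-c+d\equiv 0 \pmod L$). Floor scale modulo lifting from circulant size $2q$ to circulant size $q$ with scale value $r$ replaces each exponent $e$ by $\left\lfloor \tfrac{q}{2q}\,\bigl((r e) \bmod 2q\bigr)\right\rfloor$. **Independence model.** There are $x$ chains that form a cycle for the circulant size $2q$ and $y$ chains that do not. The entries of each chain are independent and uniform on $\{0,\dots,2q-1\}$, conditioned on the chain forming (respectively, not forming) a cycle for the circulant size $2q$. Let $D$ be the $N_r\times(x+y)$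 matrix with $D_{ij}=1$ if the $j$-th chain forms a cycle for the circulant size $q$ after lifting with scale value $r_i$, and $D_{ij}=0$ otherwise; the columns of $D$ are assumed to be independent. Let $$EC_{fsml}=\mathbf{E}\,\min_{1\le i\le N_r}\ \sum_{j} D_{ij}$$ be the expected number of cycles of length 4 after lifting with the best of the scale values $r_1,\dots,r_{N_r}$. **Theorem.** Put $p_{fl}=\dfrac{5}{4(2q-1)}$. With $q$ and $r_1,\dots,r_{N_r}$ fixed, $$EC_{fsml}=\tfrac34\,x+p_{fl}\,y-c_{N_r}\sqrt y+o(\sqrt y)\qquad (y\to\infty),$$ where $x$ may vary with $y$ in an arbitrary way. Here the constant $c_{N_r}$ does not depend on $x$ or $y$; it equals $\mathbf{E}\max_{1\le i\le N_r} Z_i$ for a Gaussian vector $Z\sim\mathcal N(0,\Sigma)$ in $\mathbb R^{N_r}$ with $\Sigma_{ii}=p_{fl}(1-p_{fl})$ and $\Sigma_{ij}=-p_{fl}^2$ for $i\ne j$. -/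

import Mathlib

open MeasureTheory ProbabilityTheory Filter Asymptotics

noncomputable section

namespace QCLDPC

/-- The `L × L` circulant permutation matrix `P`, with `P i j = 1` iff `i + 1 ≡ j (mod L)`. -/
def circulant (L : ℕ) : Matrix (Fin L) (Fin L) (ZMod 2) :=
  fun i j => if (i : ℕ) + 1 ≡ (j : ℕ) [MOD L] then 1 else 0

/-- The parity-check matrix with circulant size `L` and exponent matrix `E` (without zero blocks):
its block in position `(k, l)` is `P ^ E k l`. -/
def parityCheck {m n : Type*} (L : ℕ) (E : Matrix m n ℕ) :
    Matrix (m × Fin L) (n × Fin L) (ZMod 2) :=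
  fun u v => (circulant L ^ E u.1 v.1) u.2 v.2

/-- The Tanner graph of a binary matrix: the bipartite graph on rows and columns in which row `i`
and column `j` are adjacent iff the entry `H i j` equals `1`. -/
def tannerGraph {m n : Type*} (H : Matrix m n (ZMod 2)) : SimpleGraph (m ⊕ n) :=
  SimpleGraph.fromRel fun u v => ∃ i j, u = Sum.inl i ∧ v = Sum.inr j ∧ H i j = 1

/-- The exponent chain of length 4 with exponents `[[a, b], [c, d]]` forms a cycle for the
circulant size `L`: the Tanner graph of the matrix with blocks `[[P^a, P^b], [P^c, P^d]]`
contains a cycle of length 4. -/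
def FormsCycle (L : ℕ) (E : Matrix (Fin 2) (Fin 2) ℕ) : Prop :=
  ∃ (v : (Fin 2 × Fin L) ⊕ (Fin 2 × Fin L)) (w : (tannerGraph (parityCheck L E)).Walk v v),
    w.IsCycle ∧ w.length = 4

/-- Floor scale modulo lifting, with scale value `r`, of an exponent `e ≠ -1` from circulant size
`L₀` to circulant size `L₁`: the number `⌊(L₁ / L₀) * ((r * e) mod L₀)⌋`. -/
def floorScaleModulo (L₀ L₁ r e : ℕ) : ℕ :=
  ⌊(L₁ : ℚ) / (L₀ : ℚ) * ((r * e % L₀ : ℕ) : ℚ)⌋₊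

/-- Exponent chains `[[a, b], [c, d]]` of length 4 with exponents in `{0, …, 2q - 1}`. -/
abbrev Chain (q : ℕ) : Type := Fin 2 → Fin 2 → Fin (2 * q)

/-- The chain forms a cycle for the initial circulant size `2q`. -/
def InitialCycle (q : ℕ) (A : Chain q) : Prop :=
  FormsCycle (2 * q) fun k l => (A k l : ℕ)

/-- The chain obtained by floor scale modulo lifting from circulant size `2q` to circulant size
`q` with scale value `r` forms a cycle. -/
def LiftedCycle (q r : ℕ) (A : Chain q) : Prop :=
  FormsCycle q fun k l => floorScaleModulo (2 * q) q r (A k l)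

/-- The admissible families `r₁, …, r_N` of scale values for lifting from `2q` to `q`. -/
structure AdmissibleScales (q N : ℕ) (r : Fin N → ℕ) : Prop where
  pos : ∀ i, 0 < r i
  lt : ∀ i, r i < 2 * q
  coprime : ∀ i, (r i).Coprime (2 * q)
  distinct : ∀ i j, i ≠ j → r i ≠ r j
  not_modEq : ∀ i j, i ≠ j → ¬ r i ≡ r j * (q + 1) [MOD 2 * q]

open Classical in
/-- The column of the 0-1 matrix `D` which belongs to the chain `A`: its `i`-th entry is `1` iff
`A` forms a cycle after lifting with the scale value `r i`. -/
def column {N : ℕ} (q : ℕ) (r : Fin N → ℕ) (A : Chain q) : Fin N → ℕ :=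
  fun i => if LiftedCycle q (r i) A then 1 else 0

/-- The independence model with `x` exponent chains which form a cycle for the circulant size `2q`
(indexed by `Fin x`) and `y` exponent chains which do not (indexed by `Fin y`). The exponents of
each chain are independent and uniform on `{0, …, 2q - 1}`, conditioned on the chain forming,
resp. not forming, a cycle for the circulant size `2q`; and the columns of the matrix `D` are
independent. -/
structure IndependenceModel {N : ℕ} (q : ℕ) (r : Fin N → ℕ) (x y : ℕ)
    {Ω : Type*} [MeasurableSpace Ω] (P : Measure Ω) (A : Fin x ⊕ Fin y → Ω → Chain q) :
    Prop where
  measurable : ∀ j, Measurable (A j)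
  law_cycle : ∀ j : Fin x, P.map (A (Sum.inl j)) =
    ProbabilityTheory.cond (uniformOn (Set.univ : Set (Chain q))) {B | InitialCycle q B}
  law_noncycle : ∀ j : Fin y, P.map (A (Sum.inr j)) =
    ProbabilityTheory.cond (uniformOn (Set.univ : Set (Chain q))) {B | ¬ InitialCycle q B}
  indep_columns : iIndepFun (fun j ω => column q r (A j ω)) P

/-- The number of cycles of length 4 after floor scale modulo lifting with the best of the scale
values `r i`: the minimum over `i` of the number of chains forming a cycle after lifting with
`r i`, i.e. the minimum row sum of `D`. -/
def numCycles {N : ℕ} (q : ℕ) (r : Fin N → ℕ) {ι : Type*} [Fintype ι] (A : ι → Chain q) : ℕ :=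
  ⨅ i : Fin N, ∑ j, column q r (A j) i

/-- The probability `5 / (4 (2q - 1))`. -/
def pFl (q : ℕ) : ℝ := 5 / (4 * (2 * (q : ℝ) - 1))

/-- The `N × N` covariance matrix of a random vector which is the `i`-th unit vector with
probability `p` for each `i` and zero otherwise: `p (1 - p)` on the diagonal, `-p ^ 2` off it. -/
def covMatrix (N : ℕ) (p : ℝ) : Matrix (Fin N) (Fin N) ℝ :=
  fun i j => if i = j then p * (1 - p) else -p ^ 2

/-- The expectation of the maximal coordinate of a Gaussian vector `𝒩(0, Σ)`. -/
def gaussianMax (N : ℕ) (S : Matrix (Fin N) (Fin N) ℝ) : ℝ :=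
  ∫ z : EuclideanSpace ℝ (Fin N), (⨆ i, z i) ∂(multivariateGaussian 0 S)

end QCLDPC

end

namespace QCLDPC

/-! ### Cycles of length 4 and exponents -/

/-! For a chain let `s = a - b - c + d` and let `δ` be the same alternating sum of the parities of
the entries, so `|δ| ≤ 2`. It forms a cycle for size `2q` iff `2q ∣ s`. Since `r` is odd, twice the
lifted exponent is `r * e - (e mod 2)` modulo `2q`, so the lifted chain forms a cycle iff `2q ∣ r *
s - δ` (`liftedCycle_iff`).

If `2q ∣ s`, this says `δ = 0`, whatever `r` is: the `x` initial cycles add the same amount to every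
row sum, and `x` enters only through the mean. If `2q ∤ s`, admissibility lets at most one `r i`
produce a cycle (`not_liftedCycle_of_liftedCycle`). Such a column is zero or a unit vector, which
gives the covariance matrix `covMatrix`. The probabilities `3/4` and `pFl q` come from splitting
exponents as `2 * m + ε` (`card_chain_of_halfSum`).

Hence the minimal row sum is a common term plus `pFl q * y` minus `√y` times the maximal coordinate
of a normalized sum of `y` i.i.d. centered vectors. The central limit theorem and a uniform second
moment bound make the expectation of that maximum converge to `gaussianMax`
(`tendsto_integral_iSup_inv_sqrt_smul_sum`). -/

theorem circulant_pow_apply (L e : ℕ) (i j : Fin L) :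
    (circulant L ^ e) i j = if (i : ℕ) + e ≡ (j : ℕ) [MOD L] then 1 else 0 := by
  induction e generalizing j with
  | zero =>
    simp only [pow_zero, Matrix.one_apply, add_zero]
    congr 1
    rw [Nat.ModEq, Nat.mod_eq_of_lt i.2, Nat.mod_eq_of_lt j.2, Fin.ext_iff]
  | succ e ih =>
    have hL : 0 < L := i.pos
    rw [pow_succ, Matrix.mul_apply]
    rw [Finset.sum_eq_single (⟨((i : ℕ) + e) % L, Nat.mod_lt _ hL⟩ : Fin L)]
    · rw [ih, if_pos (Nat.mod_modEq _ _).symm, one_mul, circulant]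
      congr 1
      have h : ((i : ℕ) + e) % L + 1 ≡ i + (e + 1) [MOD L] :=
        (Nat.mod_modEq _ _).add_right 1
      exact propext ⟨fun h' => h.symm.trans h', fun h' => h.trans h'⟩
    · intro k _ hk
      rw [ih, if_neg, zero_mul]
      intro h
      apply hk
      ext
      simpa [Nat.ModEq, Nat.mod_eq_of_lt k.2] using h.symm
    · simp

theorem parityCheck_apply_eq_one_iff {m n : Type*} (L : ℕ) (E : Matrix m n ℕ)
    (u : m × Fin L) (v : n × Fin L) :
    parityCheck L E u v = 1 ↔ (u.2 : ℕ) + E u.1 v.1 ≡ (v.2 : ℕ) [MOD L] := by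
  rw [parityCheck, circulant_pow_apply]
  split_ifs <;> simp_all

@[simp]
theorem tannerGraph_adj_inl_inr {m n : Type*} (H : Matrix m n (ZMod 2)) (i : m) (j : n) :
    (tannerGraph H).Adj (Sum.inl i) (Sum.inr j) ↔ H i j = 1 := by
  simp [tannerGraph]

@[simp]
theorem tannerGraph_adj_inr_inl {m n : Type*} (H : Matrix m n (ZMod 2)) (i : m) (j : n) :
    (tannerGraph H).Adj (Sum.inr j) (Sum.inl i) ↔ H i j = 1 := by
  simp [tannerGraph]

@[simp]
theorem not_tannerGraph_adj_inl_inl {m n : Type*} (H : Matrix m n (ZMod 2)) (i j : m) :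
    ¬ (tannerGraph H).Adj (Sum.inl i) (Sum.inl j) := by
  simp [tannerGraph]

@[simp]
theorem not_tannerGraph_adj_inr_inr {m n : Type*} (H : Matrix m n (ZMod 2)) (i j : n) :
    ¬ (tannerGraph H).Adj (Sum.inr i) (Sum.inr j) := by
  simp [tannerGraph]

theorem exists_isCycle_length_four_iff {V : Type*} (G : SimpleGraph V) :
    (∃ (v : V) (w : G.Walk v v), w.IsCycle ∧ w.length = 4) ↔
      ∃ a b c d, G.Adj a b ∧ G.Adj b c ∧ G.Adj c d ∧ G.Adj d a ∧ a ≠ c ∧ b ≠ d := by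
  constructor
  · rintro ⟨v, w, hw, hl⟩
    match w, hw, hl with
    | .cons (v := b) h1 (.cons (v := c) h2 (.cons (v := d) h3 (.cons h4 .nil))), hw, _ =>
      have := hw.support_nodup
      simp only [SimpleGraph.Walk.support_cons, SimpleGraph.Walk.support_nil, List.tail_cons,
        List.nodup_cons, List.mem_cons] at this
      refine ⟨v, b, c, d, h1, h2, h3, h4, ?_, ?_⟩ <;> grind
  · rintro ⟨a, b, c, d, h1, h2, h3, h4, hac, hbd⟩
    refine ⟨a, .cons h1 (.cons h2 (.cons h3 (.cons h4 .nil))), ?_, by simp⟩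
    have e1 := h1.ne
    have e2 := h2.ne
    have e3 := h3.ne
    have e4 := h4.ne
    rw [SimpleGraph.Walk.isCycle_def]
    refine ⟨?_, by simp, ?_⟩
    · rw [SimpleGraph.Walk.isTrail_def]
      simp only [SimpleGraph.Walk.edges_cons, SimpleGraph.Walk.edges_nil, List.nodup_cons,
        List.mem_cons, Sym2.eq_iff]
      grind
    · simp only [SimpleGraph.Walk.support_cons, SimpleGraph.Walk.support_nil, List.tail_cons,
        List.nodup_cons, List.mem_cons]
      grind

theorem exists_tannerGraph_isCycle_length_four_iff {m n : Type*} (H : Matrix m n (ZMod 2)) :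
    (∃ (v : m ⊕ n) (w : (tannerGraph H).Walk v v), w.IsCycle ∧ w.length = 4) ↔
      ∃ u u' v v', u ≠ u' ∧ v ≠ v' ∧ H u v = 1 ∧ H u v' = 1 ∧ H u' v = 1 ∧ H u' v' = 1 := by
  rw [exists_isCycle_length_four_iff]
  constructor
  · rintro ⟨a | a, b | b, c | c, d | d, h1, h2, h3, h4, hac, hbd⟩ <;> simp_all
    · exact ⟨a, c, hac, b, d, hbd, h1, h4, h2, h3⟩
    · exact ⟨b, d, hbd, a, c, hac, h1, h2, h4, h3⟩
  · rintro ⟨u, u', v, v', hu, hv, h1, h2, h3, h4⟩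
    exact ⟨.inl u, .inr v, .inl u', .inr v', by simp [*]⟩

/-- Around a 4-cycle the row and column offsets cancel, leaving the alternating sum up to sign. The
two rows and the two columns must lie in different blocks, because a circulant power has a single 1
in each row and column. -/
theorem formsCycle_iff {L : ℕ} (hL : 0 < L) (E : Matrix (Fin 2) (Fin 2) ℕ) :
    FormsCycle L E ↔ (L : ℤ) ∣ E 0 0 - E 0 1 - E 1 0 + E 1 1 := by
  rw [FormsCycle, exists_tannerGraph_isCycle_length_four_iff]
  simp only [parityCheck_apply_eq_one_iff, Nat.modEq_iff_dvd, Nat.cast_add]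
  have key : ∀ i j : Fin L, (L : ℤ) ∣ (i : ℤ) - j → i = j := by
    intro i j h
    have := Int.eq_zero_of_abs_lt_dvd h (by rw [abs_lt]; omega)
    ext; omega
  constructor
  · rintro ⟨⟨k, i⟩, ⟨k', i'⟩, ⟨l, j⟩, ⟨l', j'⟩, hu, hv, h1, h2, h3, h4⟩
    simp only at h1 h2 h3 h4
    have hk : k ≠ k' := by
      rintro rfl
      apply hu
      rw [key i i' ((dvd_sub h3 h1).trans (dvd_of_eq (by ring)))]
    have hl : l ≠ l' := by
      rintro rfl
      apply hv
      rw [key j j' ((dvd_sub h1 h2).trans (dvd_of_eq (by ring)))]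
    have h := dvd_sub (dvd_sub h1 h2) (dvd_sub h3 h4)
    have h' := (dvd_neg (α := ℤ)).2 h
    fin_cases k <;> fin_cases k' <;> fin_cases l <;> fin_cases l' <;>
      simp only [ne_eq, not_true_eq_false, Fin.zero_eta, Fin.mk_one, Fin.isValue] at hk hl h h' ⊢
    · exact h'.trans (dvd_of_eq (by ring))
    · exact h.trans (dvd_of_eq (by ring))
    · exact h.trans (dvd_of_eq (by ring))
    · exact h'.trans (dvd_of_eq (by ring))
  · intro h
    -- With row offsets `E 1 0` and `E 0 0`, three of the four adjacencies hold identically; only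
    -- the one through `E 0 1` needs the divisibility.
    refine ⟨(0, ⟨E 1 0 % L, Nat.mod_lt _ hL⟩), (1, ⟨E 0 0 % L, Nat.mod_lt _ hL⟩),
      (0, ⟨(E 0 0 + E 1 0) % L, Nat.mod_lt _ hL⟩), (1, ⟨(E 0 0 + E 1 1) % L, Nat.mod_lt _ hL⟩),
      by simp, by simp, ?_⟩
    simp only [Int.natCast_mod, Nat.cast_add, Int.emod_def]
    refine ⟨?_, ?_, ?_, ?_⟩
    · exact ⟨-((E 0 0 + E 1 0 : ℤ) / L) + (E 1 0 : ℤ) / L, by ring⟩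
    · obtain ⟨c, hc⟩ := h
      exact ⟨-((E 0 0 + E 1 1 : ℤ) / L) + (E 1 0 : ℤ) / L + c, by linear_combination hc⟩
    · exact ⟨-((E 0 0 + E 1 0 : ℤ) / L) + (E 0 0 : ℤ) / L, by ring⟩
    · exact ⟨-((E 0 0 + E 1 1 : ℤ) / L) + (E 0 0 : ℤ) / L, by ring⟩

/-! ### The lifted exponents -/

theorem floorScaleModulo_two_mul {q : ℕ} (hq : 0 < q) (r e : ℕ) :
    floorScaleModulo (2 * q) q r e = r * e % (2 * q) / 2 := by
  rw [floorScaleModulo, ← Nat.floor_div_eq_div (K := ℚ)]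
  congr 1
  have : (q : ℚ) ≠ 0 := by positivity
  push_cast
  field_simp

/-- As `r` is odd and the modulus even, `r * e mod 2q` has the parity of `e`; this parity is exactly
what the floor discards. -/
theorem exists_two_mul_floorScaleModulo {q r : ℕ} (hq : 0 < q) (hr : r % 2 = 1) (e : ℕ) :
    ∃ c : ℤ, 2 * (floorScaleModulo (2 * q) q r e : ℤ) = r * e - (e % 2 : ℕ) - 2 * q * c := by
  rw [floorScaleModulo_two_mul hq]
  have h1 : r * e % (2 * q) % 2 = e % 2 := by
    rw [Nat.mod_mod_of_dvd _ (dvd_mul_right 2 q), Nat.mul_mod, hr]; simp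
  have h2 := Nat.div_add_mod (r * e % (2 * q)) 2
  have h3 := Nat.div_add_mod (r * e) (2 * q)
  refine ⟨(r * e / (2 * q) : ℕ), ?_⟩
  rw [h1] at h2
  zify at h2 h3 ⊢
  linarith

/-- The alternating sum `a - b - c + d` of a `2 × 2` array. -/
def altSum {R : Type*} [AddGroup R] (f : Fin 2 → Fin 2 → R) : R := f 0 0 - f 0 1 - f 1 0 + f 1 1

/-- The alternating sum of the exponents of a chain. -/
def expSum {q : ℕ} (A : Chain q) : ℤ := altSum fun k l => ((A k l : ℕ) : ℤ)

/-- The alternating sum of the parities of the exponents of a chain. -/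
def paritySum {q : ℕ} (A : Chain q) : ℤ := altSum fun k l => (((A k l : ℕ) % 2 : ℕ) : ℤ)

/-- The alternating sum of the halved exponents of a chain. -/
def halfSum {q : ℕ} (A : Chain q) : ℤ := altSum fun k l => (((A k l : ℕ) / 2 : ℕ) : ℤ)

theorem expSum_eq {q : ℕ} (A : Chain q) : expSum A = 2 * halfSum A + paritySum A := by
  simp only [expSum, halfSum, paritySum, altSum]
  omega

theorem abs_paritySum_le {q : ℕ} (A : Chain q) : |paritySum A| ≤ 2 := by
  simp only [paritySum, altSum]
  rw [abs_le]
  omega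

theorem initialCycle_iff {q : ℕ} (hq : 0 < q) (A : Chain q) :
    InitialCycle q A ↔ (2 * q : ℤ) ∣ expSum A := by
  refine (formsCycle_iff (by omega) _).trans ?_
  simp [expSum, altSum]

theorem liftedCycle_iff {q r : ℕ} (hq : 0 < q) (hr : r % 2 = 1) (A : Chain q) :
    LiftedCycle q r A ↔ (2 * q : ℤ) ∣ r * expSum A - paritySum A := by
  refine (formsCycle_iff hq _).trans ?_
  rw [← mul_dvd_mul_iff_left (two_ne_zero (α := ℤ))]
  obtain ⟨c, hc⟩ := exists_two_mul_floorScaleModulo hq hr (A 0 0)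
  obtain ⟨c', hc'⟩ := exists_two_mul_floorScaleModulo hq hr (A 0 1)
  obtain ⟨d, hd⟩ := exists_two_mul_floorScaleModulo hq hr (A 1 0)
  obtain ⟨d', hd'⟩ := exists_two_mul_floorScaleModulo hq hr (A 1 1)
  rw [← dvd_add_left (dvd_mul_right (2 * (q : ℤ)) (c - c' - d + d'))]
  have : ∀ x y : ℤ, x = y → (2 * (q : ℤ) ∣ x ↔ 2 * (q : ℤ) ∣ y) := by rintro x _ rfl; rfl
  apply this
  simp only [expSum, paritySum, altSum]
  linear_combination hc - hc' - hd + hd'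

section

variable {q r : ℕ}

theorem odd_of_coprime_two_mul (hr : r.Coprime (2 * q)) : r % 2 = 1 := by
  have := Nat.Coprime.coprime_dvd_right (dvd_mul_right 2 q) hr
  simpa [Nat.coprime_two_right] using! Nat.odd_iff.1 (Nat.coprime_two_right.1 this)

theorem liftedCycle_iff_of_initialCycle (hq : 2 < q) (hr : r.Coprime (2 * q)) {A : Chain q}
    (hA : InitialCycle q A) : LiftedCycle q r A ↔ paritySum A = 0 := by
  rw [liftedCycle_iff (by omega) (odd_of_coprime_two_mul hr)]
  rw [initialCycle_iff (by omega)] at hA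
  rw [dvd_sub_right (hA.mul_left _)]
  refine ⟨fun h => Int.eq_zero_of_abs_lt_dvd h ?_, fun h => h ▸ dvd_zero _⟩
  have := abs_paritySum_le A
  omega

/-- Eliminating the exponent sum from the two divisibilities leaves `2q ∣ (r - r') * δ` with `δ` the
parity sum. If `δ = 0`, coprimality would make the chain an initial cycle. Otherwise `|δ|` is 1 or
2, so `q ∣ r - r'`, which admissibility excludes. -/
theorem not_liftedCycle_of_liftedCycle {r' : ℕ} (hq : 2 < q) (hr : r.Coprime (2 * q))
    (hr' : r'.Coprime (2 * q)) (hlt : r < 2 * q) (hlt' : r' < 2 * q) (hne : r ≠ r')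
    (hmod : ¬ r ≡ r' * (q + 1) [MOD 2 * q]) {A : Chain q}
    (hA : ¬ InitialCycle q A) (h : LiftedCycle q r A) : ¬ LiftedCycle q r' A := by
  intro h'
  have o' := odd_of_coprime_two_mul hr'
  rw [initialCycle_iff (by omega)] at hA
  rw [liftedCycle_iff (by omega) (odd_of_coprime_two_mul hr)] at h
  rw [liftedCycle_iff (by omega) o'] at h'
  have hd : (2 * q : ℤ) ∣ (r - r') * paritySum A := by
    have := dvd_sub ((dvd_sub h h').mul_left r) (h.mul_left (r - r' : ℤ))
    exact this.trans (dvd_of_eq (by ring))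
  have hq2 : (q : ℤ) ∣ r - r' → False := by
    rintro ⟨c, hc⟩
    -- The scale values are distinct and lie in `[0, 2q)`, so they differ by exactly `q`.
    have hc1 : c = 1 ∨ c = -1 := by
      have : c ≠ 0 := by rintro rfl; apply hne; omega
      have h1 : c < 2 := by
        by_contra! h; nlinarith
      have h2 : -2 < c := by
        by_contra! h; nlinarith
      omega
    apply hmod
    rw [Nat.modEq_iff_dvd]
    -- For odd `r'`, `r' * (q + 1) ≡ r' + q` modulo `2q`, which is the excluded residue for either
    -- sign.
    obtain ⟨k, hk⟩ : ∃ k, r' = 2 * k + 1 := ⟨r' / 2, by omega⟩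
    subst hk
    push_cast at hc ⊢
    rcases hc1 with rfl | rfl
    · exact ⟨k, by linear_combination -hc⟩
    · exact ⟨k + 1, by linear_combination -hc⟩
  have hp := abs_le.1 (abs_paritySum_le A)
  have hcases : paritySum A = 0 ∨ paritySum A = 1 ∨ paritySum A = -1 ∨ paritySum A = 2 ∨
      paritySum A = -2 := by omega
  rcases hcases with h0 | h0 | h0 | h0 | h0 <;> rw [h0] at hd
  · rw [h0, sub_zero] at h
    refine hA (IsCoprime.dvd_of_dvd_mul_left ?_ h)
    have := (Nat.isCoprime_iff_coprime.2 hr).symm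
    exact_mod_cast this
  · exact hq2 ((dvd_mul_left (q : ℤ) 2).trans (by simpa using hd))
  · exact hq2 ((dvd_mul_left (q : ℤ) 2).trans (by simpa using (dvd_neg.2 hd)))
  · rw [mul_comm (2 : ℤ), mul_dvd_mul_iff_right two_ne_zero] at hd
    exact hq2 hd
  · rw [← dvd_neg, mul_neg, neg_neg, mul_comm (2 : ℤ), mul_dvd_mul_iff_right two_ne_zero] at hd
    exact hq2 hd

end

/-! ### Counting chains -/

section

variable {q : ℕ} [NeZero q]

/-- Writing an exponent as `2 * m + ε` with `ε < 2` and `m < q`. -/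
noncomputable def parityHalfEquiv (q : ℕ) [NeZero q] : Fin (2 * q) ≃ Fin 2 × ZMod q :=
  Equiv.ofBijective
    (fun e => (⟨(e : ℕ) % 2, Nat.mod_lt _ two_pos⟩, (((e : ℕ) / 2 : ℕ) : ZMod q))) (by
      rw [Fintype.bijective_iff_injective_and_card]
      refine ⟨fun e e' h => ?_, by simp [ZMod.card]⟩
      simp only [Prod.mk.injEq, Fin.mk.injEq, ZMod.natCast_eq_natCast_iff'] at h
      have h1 := e.2
      have h2 := e'.2
      have h3 : (e : ℕ) / 2 < q := by omega
      have h4 : (e' : ℕ) / 2 < q := by omega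
      rw [Nat.mod_eq_of_lt h3, Nat.mod_eq_of_lt h4] at h
      ext
      omega)

theorem card_altSum_eq (κ : ZMod q) :
    Nat.card {m : Fin 2 → Fin 2 → ZMod q // altSum m = κ} = q ^ 3 := by
  let e : {m : Fin 2 → Fin 2 → ZMod q // altSum m = κ} ≃ ZMod q × ZMod q × ZMod q :=
    { toFun := fun m => (m.1 0 0, m.1 0 1, m.1 1 0)
      invFun := fun x => ⟨![![x.1, x.2.1], ![x.2.2, κ - x.1 + x.2.1 + x.2.2]], by
        simp [altSum]⟩
      left_inv := fun m => by
        ext k l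
        have := m.2
        simp only [altSum] at this
        fin_cases k <;> fin_cases l <;> simp
        linear_combination -this
      right_inv := fun x => by simp }
  rw [Nat.card_congr e]
  simp
  ring

/-- Writing the exponents of a chain as `2 * m + ε`. -/
noncomputable def chainEquiv (q : ℕ) [NeZero q] :
    Chain q ≃ (Fin 2 → Fin 2 → Fin 2) × (Fin 2 → Fin 2 → ZMod q) where
  toFun A := (fun k l => (parityHalfEquiv q (A k l)).1, fun k l => (parityHalfEquiv q (A k l)).2)
  invFun x := fun k l => (parityHalfEquiv q).symm (x.1 k l, x.2 k l)
  left_inv A := by simp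
  right_inv x := by simp

/-- Over each parity pattern the halved exponents range freely over `ZMod q` subject to one linear
equation, giving `q ^ 3` solutions. Every count below thus reduces to counting among 16 parity
patterns. -/
theorem card_chain_of_halfSum (Q : ℤ → Prop) [DecidablePred Q] (κ : ℤ → ZMod q) :
    Nat.card {A : Chain q // Q (paritySum A) ∧ (halfSum A : ZMod q) = κ (paritySum A)} =
      Fintype.card {ε : Fin 2 → Fin 2 → Fin 2 // Q (altSum fun k l => ((ε k l : ℕ) : ℤ))} *
        q ^ 3 := by
  let t : (Fin 2 → Fin 2 → Fin 2) → ℤ := fun ε => altSum fun k l => ((ε k l : ℕ) : ℤ)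
  have e1 : {A : Chain q // Q (paritySum A) ∧ (halfSum A : ZMod q) = κ (paritySum A)} ≃
      {x : (Fin 2 → Fin 2 → Fin 2) × (Fin 2 → Fin 2 → ZMod q) //
        Q (t x.1) ∧ altSum x.2 = κ (t x.1)} :=
    (chainEquiv q).subtypeEquiv fun A => by
      have h : altSum (chainEquiv q A).2 = (halfSum A : ZMod q) := by
        simp only [chainEquiv, parityHalfEquiv, halfSum, altSum, Equiv.coe_fn_mk,
          Equiv.ofBijective_apply]
        push_cast [← Int.natCast_ediv]
        rfl
      rw [h]
      rfl
  let e2 : {x : (Fin 2 → Fin 2 → Fin 2) × (Fin 2 → Fin 2 → ZMod q) //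
        Q (t x.1) ∧ altSum x.2 = κ (t x.1)} ≃
      Σ ε : {ε : Fin 2 → Fin 2 → Fin 2 // Q (t ε)},
        {m : Fin 2 → Fin 2 → ZMod q // altSum m = κ (t ε)} :=
    { toFun := fun x => ⟨⟨x.1.1, x.2.1⟩, ⟨x.1.2, x.2.2⟩⟩
      invFun := fun x => ⟨(x.1.1, x.2.1), x.1.2, x.2.2⟩
      left_inv := fun _ => rfl
      right_inv := fun _ => rfl }
  rw [Nat.card_congr (e1.trans e2), Nat.card_sigma]
  simp only [card_altSum_eq, Finset.sum_const, Finset.card_univ, smul_eq_mul, t]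

theorem card_initialCycle : Nat.card {A : Chain q // InitialCycle q A} = 8 * q ^ 3 := by
  have h : ∀ A : Chain q, InitialCycle q A ↔
      (2 ∣ paritySum A) ∧ (halfSum A : ZMod q) = ((-(paritySum A / 2) : ℤ) : ZMod q) := by
    intro A
    rw [initialCycle_iff (NeZero.pos q), expSum_eq, ZMod.intCast_eq_intCast_iff_dvd_sub]
    constructor
    · intro h
      obtain ⟨k, hk⟩ : (2 : ℤ) ∣ paritySum A :=
        (dvd_add_right (dvd_mul_right 2 _)).1 ((dvd_mul_right 2 _).trans h)
      refine ⟨⟨k, hk⟩, ?_⟩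
      rw [hk, ← mul_add, mul_dvd_mul_iff_left two_ne_zero] at h
      rw [hk, Int.mul_ediv_cancel_left _ two_ne_zero, ← dvd_neg]
      convert h using 2
      ring
    · rintro ⟨⟨k, hk⟩, h⟩
      rw [hk, ← mul_add, mul_dvd_mul_iff_left two_ne_zero]
      rw [hk, Int.mul_ediv_cancel_left _ two_ne_zero, ← dvd_neg] at h
      convert h using 2
      ring
  simp_rw [h]
  rw [card_chain_of_halfSum (fun d => 2 ∣ d) (fun d => ((-(d / 2) : ℤ) : ZMod q))]
  -- Evaluation: 8 of the 16 patterns have even alternating sum.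
  congr 1

variable {r : ℕ}

theorem card_liftedCycle (hr : r.Coprime (2 * q)) :
    Nat.card {A : Chain q // LiftedCycle q r A} = 16 * q ^ 3 := by
  have ho := odd_of_coprime_two_mul hr
  obtain ⟨ρ, hρ⟩ : ∃ ρ, r = 2 * ρ + 1 := ⟨r / 2, by omega⟩
  have hu : IsUnit (r : ZMod q) :=
    (ZMod.isUnit_iff_coprime r q).2 (hr.coprime_dvd_right (dvd_mul_left q 2))
  have h : ∀ A : Chain q, LiftedCycle q r A ↔
      True ∧ (halfSum A : ZMod q) = -(r : ZMod q)⁻¹ * ((ρ : ZMod q) * (paritySum A : ZMod q)) := by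
    intro A
    -- Since `r` is a unit modulo `q`, this factorization determines the half sum for every parity
    -- pattern, so all 16 patterns contribute.
    have e : (r : ℤ) * expSum A - paritySum A = 2 * (r * halfSum A + ρ * paritySum A) := by
      rw [expSum_eq, hρ]; push_cast; ring
    rw [liftedCycle_iff (NeZero.pos q) ho, e, mul_dvd_mul_iff_left two_ne_zero, true_and,
      ← ZMod.intCast_zmod_eq_zero_iff_dvd]
    push_cast
    have hi := ZMod.inv_mul_of_unit _ hu
    have hi' := ZMod.mul_inv_of_unit _ hu
    constructor
    · intro h
      linear_combination (r : ZMod q)⁻¹ * h - (halfSum A : ZMod q) * hi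
    · intro h
      linear_combination (r : ZMod q) * h - ((ρ : ZMod q) * (paritySum A : ZMod q)) * hi'
  simp_rw [h]
  rw [card_chain_of_halfSum (fun _ => True) (fun d =>
    -(r : ZMod q)⁻¹ * ((ρ : ZMod q) * (d : ZMod q)))]
  congr 1

theorem card_initialCycle_and_liftedCycle (hq : 2 < q) (hr : r.Coprime (2 * q)) :
    Nat.card {A : Chain q // InitialCycle q A ∧ LiftedCycle q r A} = 6 * q ^ 3 := by
  have h : ∀ A : Chain q, (InitialCycle q A ∧ LiftedCycle q r A) ↔
      paritySum A = 0 ∧ (halfSum A : ZMod q) = 0 := by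
    intro A
    rw [and_congr_right fun hA => liftedCycle_iff_of_initialCycle hq hr hA, and_comm,
      and_congr_right_iff]
    intro h0
    rw [initialCycle_iff (by omega), expSum_eq, h0, add_zero, mul_dvd_mul_iff_left two_ne_zero,
      ZMod.intCast_zmod_eq_zero_iff_dvd]
  simp_rw [h]
  rw [card_chain_of_halfSum (fun d => d = 0) (fun _ => (0 : ZMod q))]
  -- Evaluation: 6 of the 16 patterns have alternating sum 0.
  congr 1

end

/-! ### A multivariate central limit theorem for triangular arrays -/

section

open scoped Topology RealInnerProductSpace

/-- The central limit theorem for an i.i.d. sequence, realized on an infinite product, read off at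
the level of characteristic functions. In this form only `μ` appears, so it applies to arrays whose
probability space changes with `n`. -/
theorem tendsto_charFun_pow_of_centered (μ : Measure ℝ) [IsProbabilityMeasure μ]
    (hμ : MemLp id 2 μ) (h0 : ∫ x, x ∂μ = 0) (t : ℝ) :
    Tendsto (fun n : ℕ => charFun μ ((√(n : ℝ))⁻¹ * t) ^ n) atTop
      (𝓝 (Complex.exp (-(Var[id; μ] * t ^ 2 / 2 : ℝ)))) := by
  let P := Measure.infinitePi fun _ : ℕ => μ
  let X : ℕ → (ℕ → ℝ) → ℝ := fun k ω => ω k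
  have hmap : ∀ k, P.map (X k) = μ := fun k => Measure.infinitePi_map_eval (fun _ : ℕ => μ) k
  have hmeas : ∀ k, Measurable (X k) := fun k => measurable_pi_apply k
  have hindep : iIndepFun X P := iIndepFun_infinitePi (X := fun _ x => x) fun _ => measurable_id
  have hident : ∀ k, IdentDistrib (X k) (X 0) P P := fun k =>
    ⟨(hmeas k).aemeasurable, (hmeas 0).aemeasurable, by rw [hmap, hmap]⟩
  have hmean : P[X 0] = 0 := by
    rw [← h0, ← hmap 0, integral_map (hmeas 0).aemeasurable (by fun_prop)]
  have hvar : Var[X 0; P] = Var[id; μ] := by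
    conv_rhs => rw [← hmap 0]
    rw [variance_map (by fun_prop) (hmeas 0).aemeasurable]
    rfl
  have hL : MemLp (X 0) 2 P := by
    have := (memLp_map_measure_iff (f := X 0) (μ := P) (g := id) (p := 2)
      (by fun_prop) (hmeas 0).aemeasurable).1 (by rwa [hmap])
    exact this
  have hY : HasLaw id (gaussianReal 0 Var[X 0; P].toNNReal)
    (gaussianReal 0 Var[X 0; P].toNNReal) := ⟨by fun_prop, by simp⟩
  have h := (tendstoInDistribution_inv_sqrt_mul_sum_sub hY hL hindep hident).tendsto
  have h' := (ProbabilityMeasure.tendsto_iff_tendsto_charFun.1 h) t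
  simp only [ProbabilityMeasure.coe_mk, hmean, mul_zero, sub_zero, Measure.map_id,
    charFun_inv_sqrt_mul_sum hindep hident, hmap, charFun_gaussianReal] at h'
  convert h' using 2
  rw [hvar, Real.coe_toNNReal _ (variance_nonneg _ _)]
  push_cast
  simp

variable {ι : Type*} [Fintype ι]

/-- The Cramér–Wold device: the one-dimensional statement at the point 1 for the law of `⟪x, t⟫`. -/
theorem tendsto_charFun_pow_of_centered_inner (μ : Measure (EuclideanSpace ℝ ι))
    [IsProbabilityMeasure μ] (hμ : MemLp id 2 μ) (h0 : ∫ x, x ∂μ = 0)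
    (t : EuclideanSpace ℝ ι) :
    Tendsto (fun n : ℕ => charFun μ ((√(n : ℝ))⁻¹ • t) ^ n) atTop
      (𝓝 (Complex.exp (-(Var[fun x => ⟪x, t⟫; μ] / 2 : ℝ)))) := by
  have hm : Measurable fun x : EuclideanSpace ℝ ι => ⟪x, t⟫ := by fun_prop
  have : IsProbabilityMeasure (μ.map fun x => ⟪x, t⟫) :=
    Measure.isProbabilityMeasure_map hm.aemeasurable
  have hL : MemLp (fun x => ⟪x, t⟫) 2 μ := hμ.inner_const t
  have h := tendsto_charFun_pow_of_centered (μ.map fun x => ⟪x, t⟫)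
    ((memLp_map_measure_iff (by fun_prop) hm.aemeasurable).2 hL) (by
      rw [integral_map hm.aemeasurable (by fun_prop)]
      simp_rw [real_inner_comm]
      rw [integral_inner (f := fun x => x) (hμ.integrable (by norm_num)), h0,
        inner_zero_right]) 1
  rw [variance_map (by fun_prop) hm.aemeasurable] at h
  convert h using 3 with n
  · rw [charFun_apply, charFun_apply, integral_map hm.aemeasurable (by fun_prop)]
    simp [real_inner_smul_right, mul_comm]
  · simp

theorem posSemidef_of_variance_inner [DecidableEq ι] {μ : Measure (EuclideanSpace ℝ ι)}
    {S : Matrix ι ι ℝ} (hS : S.IsSymm)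
    (hvar : ∀ t : EuclideanSpace ℝ ι, Var[fun x => ⟪x, t⟫; μ] = t ⬝ᵥ S.mulVec t) :
    S.PosSemidef := by
  refine Matrix.PosSemidef.of_dotProduct_mulVec_nonneg ?_ fun x => ?_
  · rw [Matrix.IsHermitian, Matrix.conjTranspose_eq_transpose_of_trivial]
    exact hS
  · have := hvar (WithLp.toLp 2 x)
    simp only [star_trivial]
    rw [← this]
    exact variance_nonneg _ _

/-- The normalized row sums of a triangular array of centered i.i.d. random vectors converge
weakly to the Gaussian measure with the same covariance matrix. -/
theorem tendsto_map_inv_sqrt_smul_sum [DecidableEq ι] {Ω : ℕ → Type*}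
    [∀ n, MeasurableSpace (Ω n)] (P : ∀ n, Measure (Ω n)) [∀ n, IsProbabilityMeasure (P n)]
    (V : ∀ n, Fin n → Ω n → EuclideanSpace ℝ ι) (hV : ∀ n j, Measurable (V n j))
    (hindep : ∀ n, iIndepFun (V n) (P n)) (μ : Measure (EuclideanSpace ℝ ι))
    [IsProbabilityMeasure μ] (hlaw : ∀ n j, (P n).map (V n j) = μ) (hμ : MemLp id 2 μ)
    (h0 : ∫ x, x ∂μ = 0) {S : Matrix ι ι ℝ} (hS : S.IsSymm)
    (hvar : ∀ t : EuclideanSpace ℝ ι, Var[fun x => ⟪x, t⟫; μ] = t ⬝ᵥ S.mulVec t)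
    (hW : ∀ n : ℕ, AEMeasurable (fun ω => (√(n : ℝ))⁻¹ • ∑ j, V n j ω) (P n)) :
    Tendsto (β := ProbabilityMeasure (EuclideanSpace ℝ ι))
      (fun n : ℕ => ⟨(P n).map fun ω => (√(n : ℝ))⁻¹ • ∑ j, V n j ω,
        Measure.isProbabilityMeasure_map (hW n)⟩) atTop
      (𝓝 ⟨multivariateGaussian 0 S, inferInstance⟩) := by
  refine ProbabilityMeasure.tendsto_iff_tendsto_charFun.2 fun t => ?_
  simp only [ProbabilityMeasure.coe_mk]
  rw [charFun_multivariateGaussian (posSemidef_of_variance_inner hS hvar)]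
  -- Independence makes the characteristic function of the row sum an `n`-th power; Lévy's
  -- continuity theorem was invoked above.
  convert tendsto_charFun_pow_of_centered_inner μ hμ h0 t using 2 with n
  · rw [charFun_map_smul_comp (by fun_prop), (hindep n).charFun_map_fun_sum_eq_prod
      fun j => (hV n j).aemeasurable]
    simp [hlaw]
  · rw [hvar]
    simp

/-! ### Convergence of expectations -/

/-- Clipping changes nothing when `|a| ≤ K`, and otherwise costs at most `|a| ≤ a ^ 2 / K`. Second
moments therefore control the error of replacing a function by a bounded one. -/
theorem abs_sub_clip_le (a K : ℝ) (hK : 0 < K) : |a - max (-K) (min K a)| ≤ a ^ 2 / K := by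
  rw [le_div_iff₀ hK]
  rcases le_total K a with h | h
  · rw [min_eq_left h, max_eq_right (by linarith), abs_of_nonneg (by linarith)]
    nlinarith
  · rw [min_eq_right h]
    rcases le_total (-K) a with h' | h'
    · rw [max_eq_right h']
      simp only [sub_self, abs_zero, zero_mul]
      positivity
    · rw [max_eq_left h', abs_of_nonpos (by linarith)]
      nlinarith

theorem abs_integral_sub_integral_clip_le {E : Type*} [MeasurableSpace E] (μ : Measure E)
    [IsProbabilityMeasure μ] {f : E → ℝ} (hf : MemLp f 2 μ) {K : ℝ} (hK : 0 < K) :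
    |∫ x, f x ∂μ - ∫ x, max (-K) (min K (f x)) ∂μ| ≤ (∫ x, f x ^ 2 ∂μ) / K := by
  have hi : Integrable f μ := hf.integrable (by norm_num)
  have hc : Integrable (fun x => max (-K) (min K (f x))) μ :=
    (integrable_const (-K)).sup ((integrable_const K).inf hi)
  rw [← integral_sub hi hc, ← integral_div]
  refine (abs_integral_le_integral_abs).trans ?_
  exact integral_mono (hi.sub hc).abs (hf.integrable_sq.div_const K)
    fun x => abs_sub_clip_le (f x) K hK

/-- Weak convergence and bounded second moments imply the convergence of expectations. -/
theorem tendsto_integral_of_tendsto_of_integral_sq_le {E : Type*} [TopologicalSpace E]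
    [MeasurableSpace E] [OpensMeasurableSpace E] {μ : ℕ → ProbabilityMeasure E}
    {ν : ProbabilityMeasure E} (h : Tendsto μ atTop (𝓝 ν)) {f : E → ℝ} (hf : Continuous f)
    (hμ : ∀ n, MemLp f 2 (μ n : Measure E)) (hν : MemLp f 2 (ν : Measure E)) (C : ℝ)
    (hC : ∀ n, ∫ x, f x ^ 2 ∂(μ n : Measure E) ≤ C) :
    Tendsto (fun n => ∫ x, f x ∂(μ n : Measure E)) atTop (𝓝 (∫ x, f x ∂(ν : Measure E))) := by
  rw [Metric.tendsto_atTop]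
  intro ε hε
  set D := max C (∫ x, f x ^ 2 ∂(ν : Measure E)) with hD
  have hD0 : 0 ≤ D := (integral_nonneg fun x => sq_nonneg _).trans (le_max_right _ _)
  -- Chosen so that each of the two clipping errors, at most `D / K`, is below `ε / 3`; the `+ 1`
  -- keeps `K` positive when `D = 0`.
  set K := 3 * (D + 1) / ε with hKdef
  have hK : 0 < K := by positivity
  have hDK : D / K < ε / 3 := by
    rw [div_lt_iff₀ hK, hKdef, div_mul_div_comm, mul_comm ε, mul_div_mul_right _ _ hε.ne']
    linarith
  let g : BoundedContinuousFunction E ℝ := BoundedContinuousFunction.ofNormedAddCommGroup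
    (fun x => max (-K) (min K (f x))) (by fun_prop) K fun x => by
      rw [Real.norm_eq_abs, abs_le]
      exact ⟨le_max_left _ _, max_le (by linarith) (min_le_left _ _)⟩
  have hg := (ProbabilityMeasure.tendsto_iff_forall_integral_tendsto.1 h) g
  obtain ⟨n₀, hn₀⟩ := Metric.tendsto_atTop.1 hg (ε / 3) (by positivity)
  refine ⟨n₀, fun n hn => ?_⟩
  have h1 := hn₀ n hn
  have h2 := (abs_integral_sub_integral_clip_le (μ n : Measure E) (hμ n) hK).trans
    ((div_le_div_of_nonneg_right ((hC n).trans (le_max_left _ _)) hK.le).trans hDK.le)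
  have h3 := (abs_integral_sub_integral_clip_le (ν : Measure E) hν hK).trans_lt
    ((div_le_div_of_nonneg_right (le_max_right _ _) hK.le).trans_lt hDK)
  rw [Real.dist_eq] at h1 ⊢
  change |∫ x, max (-K) (min K (f x)) ∂(μ n : Measure E) -
    ∫ x, max (-K) (min K (f x)) ∂(ν : Measure E)| < ε / 3 at h1
  rw [abs_lt] at h1 h3 ⊢
  rw [abs_le] at h2
  constructor <;> linarith [h1.1, h1.2, h2.1, h2.2, h3.1, h3.2]

/-! ### The maximal coordinate -/

theorem continuous_iSup_apply [Nonempty ι] :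
    Continuous fun z : EuclideanSpace ℝ ι => ⨆ i, z i := by
  have : (fun z : EuclideanSpace ℝ ι => ⨆ i, z i) =
      fun z => Finset.univ.sup' Finset.univ_nonempty fun i => z i := by
    ext z
    rw [Finset.sup'_univ_eq_ciSup]
  rw [this]
  exact Continuous.finset_sup'_apply _ fun i _ => by fun_prop

theorem abs_iSup_apply_le [Nonempty ι] (z : EuclideanSpace ℝ ι) : |⨆ i, z i| ≤ ‖z‖ := by
  obtain ⟨i, hi⟩ := exists_eq_ciSup_of_finite (f := fun i => z i)
  rw [← hi]
  exact PiLp.norm_apply_le z i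

theorem memLp_iSup_apply [Nonempty ι] {μ : Measure (EuclideanSpace ℝ ι)} (hμ : MemLp id 2 μ) :
    MemLp (fun z : EuclideanSpace ℝ ι => ⨆ i, z i) 2 μ :=
  hμ.mono continuous_iSup_apply.aestronglyMeasurable
    (Eventually.of_forall fun z => abs_iSup_apply_le z)

/-- Coordinatewise the variances of independent summands add, and the factor `1 / n` cancels their
number. The bound is uniform in `n`, as the passage from weak convergence to expectations requires.
-/
theorem integral_norm_sq_inv_sqrt_smul_sum_le {Ω : Type*} [MeasurableSpace Ω] (P : Measure Ω)
    [IsProbabilityMeasure P] {n : ℕ} (V : Fin n → Ω → EuclideanSpace ℝ ι)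
    (hV : ∀ j, Measurable (V j)) (hindep : iIndepFun V P) (μ : Measure (EuclideanSpace ℝ ι))
    (hlaw : ∀ j, P.map (V j) = μ) (hμ : MemLp id 2 μ) (h0 : ∫ x, x ∂μ = 0) :
    ∫ ω, ‖(√(n : ℝ))⁻¹ • ∑ j, V j ω‖ ^ 2 ∂P ≤ ∑ i, Var[fun x => x i; μ] := by
  have hL : ∀ j, MemLp (V j) 2 P := fun j =>
    (memLp_map_measure_iff (g := id) (by fun_prop) (hV j).aemeasurable).1 (by rwa [hlaw])
  have hcm : ∀ i, Measurable fun x : EuclideanSpace ℝ ι => x i := fun i => by fun_prop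
  have hLi : ∀ i j, MemLp (fun ω => V j ω i) 2 P := fun i j =>
    (hL j).mono ((hcm i).comp (hV j)).aestronglyMeasurable
      (Eventually.of_forall fun ω => PiLp.norm_apply_le (V j ω) i)
  have hmean : ∀ i j, ∫ ω, V j ω i ∂P = 0 := by
    intro i j
    have hi : Integrable (fun ω => V j ω) P := (hL j).integrable (by norm_num)
    have e' : ∫ ω, V j ω ∂P = 0 := by
      rw [← h0, ← hlaw j, integral_map (hV j).aemeasurable (by fun_prop)]
    have := ContinuousLinearMap.integral_comp_comm (EuclideanSpace.proj (𝕜 := ℝ) i) hi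
    rw [e', map_zero] at this
    exact this
  have hsum : ∀ i, ∫ ω, (∑ j, V j ω i) ^ 2 ∂P = n * Var[fun x => x i; μ] := by
    intro i
    have hv := IndepFun.variance_sum (μ := P) (s := Finset.univ)
      (X := fun j ω => V j ω i) (fun j _ => hLi i j) (fun j _ k _ hjk =>
        (hindep.indepFun hjk).comp (hcm i) (hcm i))
    have hs : (∑ j, fun ω => V j ω i) = fun ω => ∑ j, V j ω i := by ext; simp
    have hm : Measurable fun ω => ∑ j, V j ω i :=
      Finset.measurable_fun_sum _ fun j _ => (hcm i).comp (hV j)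
    rw [hs, variance_eq_integral hm.aemeasurable,
      integral_finsetSum _ fun j _ => (hLi i j).integrable (by norm_num)] at hv
    simp only [hmean, Finset.sum_const_zero, sub_zero] at hv
    rw [hv]
    have : ∀ j, Var[fun ω => V j ω i; P] = Var[fun x => x i; μ] := by
      intro j
      rw [← hlaw j, variance_map (hcm i).aemeasurable (hV j).aemeasurable]
      rfl
    simp [this]
  have hexp : ∀ ω, ‖(√(n : ℝ))⁻¹ • ∑ j, V j ω‖ ^ 2 = (n : ℝ)⁻¹ * ∑ i, (∑ j, V j ω i) ^ 2 := by
    intro ω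
    rw [norm_smul, mul_pow, EuclideanSpace.real_norm_sq_eq]
    simp [Real.sq_sqrt]
  simp_rw [hexp]
  rw [integral_const_mul, integral_finsetSum]
  · simp_rw [hsum]
    rw [← Finset.mul_sum, ← mul_assoc]
    -- For `n = 0` the left side is 0; this is the only reason for an inequality.
    rcases eq_or_ne (n : ℝ) 0 with h | h
    · rw [h]
      simpa using Finset.sum_nonneg fun i _ => variance_nonneg _ _
    · rw [inv_mul_cancel₀ h, one_mul]
  · intro i _
    exact (memLp_finsetSum _ fun j _ => hLi i j).integrable_sq

/-- The expected maximal coordinate of the normalized row sums of a triangular array of centered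
i.i.d. random vectors converges to the one of the Gaussian vector with the same covariance. -/
theorem tendsto_integral_iSup_inv_sqrt_smul_sum {N : ℕ} [NeZero N] {Ω : ℕ → Type*}
    [∀ n, MeasurableSpace (Ω n)] (P : ∀ n, Measure (Ω n)) [∀ n, IsProbabilityMeasure (P n)]
    (V : ∀ n, Fin n → Ω n → EuclideanSpace ℝ (Fin N)) (hV : ∀ n j, Measurable (V n j))
    (hindep : ∀ n, iIndepFun (V n) (P n)) (μ : Measure (EuclideanSpace ℝ (Fin N)))
    [IsProbabilityMeasure μ] (hlaw : ∀ n j, (P n).map (V n j) = μ) (hμ : MemLp id 2 μ)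
    (h0 : ∫ x, x ∂μ = 0) {S : Matrix (Fin N) (Fin N) ℝ} (hS : S.IsSymm)
    (hvar : ∀ t : EuclideanSpace ℝ (Fin N), Var[fun x => ⟪x, t⟫; μ] = t ⬝ᵥ S.mulVec t) :
    Tendsto (fun n : ℕ => ∫ ω, ⨆ i, ((√(n : ℝ))⁻¹ • ∑ j, V n j ω) i ∂(P n)) atTop
      (𝓝 (gaussianMax N S)) := by
  have hW : ∀ n : ℕ, AEMeasurable (fun ω => (√(n : ℝ))⁻¹ • ∑ j, V n j ω) (P n) := fun n => by
    have := hV n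
    fun_prop
  have hL : ∀ n j, MemLp (V n j) 2 (P n) := fun n j =>
    (memLp_map_measure_iff (g := id) (by fun_prop) (hV n j).aemeasurable).1 (by rwa [hlaw])
  have hWL : ∀ n : ℕ, MemLp (fun ω => (√(n : ℝ))⁻¹ • ∑ j, V n j ω) 2 (P n) := fun n => by
    exact (memLp_finsetSum Finset.univ fun j _ => hL n j).const_smul (√(n : ℝ))⁻¹
  have hfL : ∀ n : ℕ, MemLp (fun z : EuclideanSpace ℝ (Fin N) => ⨆ i, z i) 2
      ((P n).map fun ω => (√(n : ℝ))⁻¹ • ∑ j, V n j ω) := fun n =>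
    memLp_iSup_apply ((memLp_map_measure_iff (by fun_prop) (hW n)).2 (hWL n))
  have h := tendsto_integral_of_tendsto_of_integral_sq_le
    (tendsto_map_inv_sqrt_smul_sum P V hV hindep μ hlaw hμ h0 hS hvar hW)
    (continuous_iSup_apply (ι := Fin N)) hfL
    (memLp_iSup_apply (IsGaussian.memLp_two_id (μ := multivariateGaussian 0 S)))
    (∑ i, Var[fun x => x i; μ]) (fun n => by
      simp only [ProbabilityMeasure.coe_mk]
      have hc : Continuous fun z : EuclideanSpace ℝ (Fin N) => (⨆ i, z i) ^ 2 :=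
        continuous_iSup_apply.pow 2
      rw [integral_map (hW n) hc.aestronglyMeasurable]
      refine le_trans (integral_mono_of_nonneg (Eventually.of_forall fun ω => sq_nonneg _)
        (hWL n).norm.integrable_sq (Eventually.of_forall fun ω => ?_))
        (integral_norm_sq_inv_sqrt_smul_sum_le (P n) (V n) (hV n) (hindep n) μ (hlaw n) hμ h0)
      exact sq_le_sq' (abs_le.1 (abs_iSup_apply_le _)).1 (abs_le.1 (abs_iSup_apply_le _)).2)
  refine h.congr fun n => ?_
  simp only [ProbabilityMeasure.coe_mk]
  rw [integral_map (hW n) continuous_iSup_apply.aestronglyMeasurable]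

end

/-! ### Random chains -/

section

open scoped RealInnerProductSpace

theorem memLp_of_finite {α E : Type*} [Finite α] [MeasurableSpace α] [MeasurableSingletonClass α]
    [NormedAddCommGroup E] (μ : Measure α) [IsFiniteMeasure μ] (f : α → E) (p : ENNReal) :
    MemLp f p μ := by
  have := Fintype.ofFinite α
  refine MemLp.of_bound StronglyMeasurable.of_discrete.aestronglyMeasurable (∑ a, ‖f a‖)
    (Eventually.of_forall fun a => ?_)
  exact Finset.single_le_sum (f := fun a => ‖f a‖) (fun _ _ => norm_nonneg _) (Finset.mem_univ a)

theorem cond_uniformOn_univ_real {α : Type*} [Fintype α] [Nonempty α] [MeasurableSpace α]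
    [MeasurableSingletonClass α] (s t : Set α) :
    (ProbabilityTheory.cond (uniformOn (Set.univ : Set α)) s).real t =
      (Nat.card {a // a ∈ s ∧ a ∈ t} : ℝ) / Nat.card {a // a ∈ s} := by
  have h : ∀ u : Set α, (uniformOn (Set.univ : Set α)).real u =
      (Nat.card {a // a ∈ u} : ℝ) / Fintype.card α := by
    intro u
    rw [Measure.real, uniformOn_univ, Measure.count_apply_finite _ u.toFinite, ENNReal.toReal_div]
    simp [Nat.card_coe_set_eq, ← Set.ncard_eq_toFinset_card]
  have hc : (Fintype.card α : ℝ) ≠ 0 := by simp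
  rw [Measure.real, cond_apply s.toFinite.measurableSet, ENNReal.toReal_mul, ENNReal.toReal_inv]
  change ((uniformOn Set.univ).real s)⁻¹ * (uniformOn Set.univ).real (s ∩ t) = _
  rw [h, h]
  have : Nat.card {a // a ∈ s ∩ t} = Nat.card {a // a ∈ s ∧ a ∈ t} := rfl
  rw [this]
  field_simp

variable {q : ℕ}

theorem isProbabilityMeasure_cond_uniformOn_univ {α : Type*} [Finite α] [MeasurableSpace α]
    [MeasurableSingletonClass α] {s : Set α} (hs : s.Nonempty) :
    IsProbabilityMeasure (ProbabilityTheory.cond (uniformOn (Set.univ : Set α)) s) := by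
  apply cond_isProbabilityMeasure
  rw [Ne, uniformOn_eq_zero_iff Set.finite_univ, Set.univ_inter]
  exact hs.ne_empty

open Classical in
theorem card_not_initialCycle (hq : 0 < q) :
    (Nat.card {A : Chain q // ¬ InitialCycle q A} : ℝ) = 16 * q ^ 4 - 8 * q ^ 3 := by
  have : NeZero q := ⟨hq.ne'⟩
  have h := Nat.card_congr (Equiv.sumCompl fun A : Chain q => InitialCycle q A)
  rw [Nat.card_sum, card_initialCycle] at h
  have h2 : Nat.card (Chain q) = 16 * q ^ 4 := by
    simp
    ring
  rw [h2] at h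
  have h3 : (8 * (q : ℝ) ^ 3 + Nat.card {A : Chain q // ¬ InitialCycle q A}) = 16 * q ^ 4 := by
    exact_mod_cast h
  linarith

open Classical in
-- Complementary count: 16 - 6 = 10.
theorem card_not_initialCycle_and_liftedCycle (hq : 2 < q) {r : ℕ} (hr : r.Coprime (2 * q)) :
    Nat.card {A : Chain q // ¬ InitialCycle q A ∧ LiftedCycle q r A} = 10 * q ^ 3 := by
  have : NeZero q := ⟨by omega⟩
  have h := Nat.card_congr (Equiv.sumCompl
    fun A : {A : Chain q // LiftedCycle q r A} => InitialCycle q A)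
  rw [Nat.card_sum, card_liftedCycle hr] at h
  have e1 := Nat.card_congr (Equiv.subtypeSubtypeEquivSubtypeInter
    (fun A : Chain q => LiftedCycle q r A) (fun A => InitialCycle q A))
  have e2 := Nat.card_congr (Equiv.subtypeSubtypeEquivSubtypeInter
    (fun A : Chain q => LiftedCycle q r A) (fun A => ¬ InitialCycle q A))
  rw [e1, e2] at h
  simp_rw [and_comm (a := LiftedCycle q r _)] at h
  rw [card_initialCycle_and_liftedCycle hq hr] at h
  omega

/-- The law of a uniform chain conditioned on forming a cycle for the circulant size `2q`. -/
noncomputable def cycleLaw (q : ℕ) : Measure (Chain q) :=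
  ProbabilityTheory.cond (uniformOn (Set.univ : Set (Chain q))) {B | InitialCycle q B}

/-- The law of a uniform chain conditioned on not forming a cycle for the circulant size `2q`. -/
noncomputable def noncycleLaw (q : ℕ) : Measure (Chain q) :=
  ProbabilityTheory.cond (uniformOn (Set.univ : Set (Chain q))) {B | ¬ InitialCycle q B}

theorem isProbabilityMeasure_noncycleLaw (hq : 0 < q) : IsProbabilityMeasure (noncycleLaw q) := by
  apply isProbabilityMeasure_cond_uniformOn_univ
  have h : 0 < Nat.card {A : Chain q // ¬ InitialCycle q A} := by
    have h1 : (1 : ℝ) ≤ q := by exact_mod_cast hq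
    have : (0 : ℝ) < Nat.card {A : Chain q // ¬ InitialCycle q A} := by
      rw [card_not_initialCycle hq]
      have : (0 : ℝ) < q ^ 3 := by positivity
      nlinarith
    exact_mod_cast this
  obtain ⟨⟨A, hA⟩⟩ := (Nat.card_pos_iff.1 h).1
  exact ⟨A, hA⟩

variable {r : ℕ}

theorem cycleLaw_real_liftedCycle (hq : 2 < q) (hr : r.Coprime (2 * q)) :
    (cycleLaw q).real {B | LiftedCycle q r B} = 3 / 4 := by
  have : NeZero q := ⟨by omega⟩
  have hq0 : (q : ℝ) ≠ 0 := by simpa using this.ne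
  rw [cycleLaw, cond_uniformOn_univ_real]
  simp only [Set.mem_ofPred_eq]
  rw [card_initialCycle, card_initialCycle_and_liftedCycle hq hr]
  push_cast
  field_simp
  norm_num

theorem noncycleLaw_real_liftedCycle (hq : 2 < q) (hr : r.Coprime (2 * q)) :
    (noncycleLaw q).real {B | LiftedCycle q r B} = pFl q := by
  have : NeZero q := ⟨by omega⟩
  have hq0 : (q : ℝ) ≠ 0 := by simpa using this.ne
  have hq1 : (2 : ℝ) < q := by exact_mod_cast hq
  have hq2 : (2 * (q : ℝ) - 1) ≠ 0 := by linarith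
  rw [noncycleLaw, cond_uniformOn_univ_real]
  simp only [Set.mem_ofPred_eq]
  rw [card_not_initialCycle (by omega), card_not_initialCycle_and_liftedCycle hq hr, pFl]
  have : 16 * (q : ℝ) ^ 4 - 8 * q ^ 3 = 8 * q ^ 3 * (2 * q - 1) := by ring
  rw [this]
  push_cast
  field_simp
  norm_num

variable {N : ℕ} {R : Fin N → ℕ}

theorem integral_column (μ : Measure (Chain q)) (i : Fin N) :
    ∫ B, (column q R B i : ℝ) ∂μ = μ.real {B | LiftedCycle q (R i) B} := by
  rw [← integral_indicator_one (Set.toFinite _).measurableSet]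
  congr with B
  by_cases h : LiftedCycle q (R i) B <;> simp [column, h]

/-- On the diagonal the entry is 0 or 1, hence equal to its square. Off the diagonal the product
vanishes almost surely, since no non-cycle is turned into a cycle by two scale values. -/
theorem covariance_column (hq : 2 < q) (hR : AdmissibleScales q N R) (i j : Fin N) :
    cov[fun B => (column q R B i : ℝ), fun B => (column q R B j : ℝ); noncycleLaw q] =
      covMatrix N (pFl q) i j := by
  have := isProbabilityMeasure_noncycleLaw (q := q) (by omega)
  have hE : ∀ i, ∫ B, (column q R B i : ℝ) ∂(noncycleLaw q) = pFl q := fun i => by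
    rw [integral_column, noncycleLaw_real_liftedCycle hq (hR.coprime i)]
  rw [covariance_eq_sub (memLp_of_finite _ _ _) (memLp_of_finite _ _ _), hE, hE, covMatrix]
  split_ifs with hij
  · subst hij
    have : (fun B => (column q R B i : ℝ)) * (fun B => (column q R B i : ℝ)) =
        fun B => (column q R B i : ℝ) := by
      ext B
      by_cases h : LiftedCycle q (R i) B <;> simp [column, h]
    rw [this, hE]
    ring
  · have : ∫ B, ((fun B => (column q R B i : ℝ)) * (fun B => (column q R B j : ℝ))) B
        ∂(noncycleLaw q) = 0 := by
      apply integral_eq_zero_of_ae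
      have hae : ∀ᵐ B ∂(noncycleLaw q), B ∈ {B | ¬ InitialCycle q B} :=
        ae_cond_mem (Set.toFinite _).measurableSet
      filter_upwards [hae] with B hB
      by_cases h : LiftedCycle q (R i) B
      · have h' := not_liftedCycle_of_liftedCycle hq (hR.coprime i) (hR.coprime j) (hR.lt i)
          (hR.lt j) (hR.distinct i j hij) (hR.not_modEq i j hij) hB h
        simp [column, h']
      · simp [column, h]
    rw [this]
    ring

theorem covMatrix_isSymm (N : ℕ) (p : ℝ) : (covMatrix N p).IsSymm := by
  ext i j
  simp [covMatrix, eq_comm]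

/-- The centered and negated column of `D` as a vector in Euclidean space. -/
noncomputable def centeredColumn (p : ℝ) (c : Fin N → ℕ) : EuclideanSpace ℝ (Fin N) :=
  WithLp.toLp 2 fun i => p - c i

/-- The law of the centered and negated column of `D` which belongs to a chain that does not form
a cycle for the circulant size `2q`. -/
noncomputable def centeredColumnLaw (q : ℕ) (R : Fin N → ℕ) : Measure (EuclideanSpace ℝ (Fin N)) :=
  (noncycleLaw q).map fun B => centeredColumn (pFl q) (column q R B)

theorem isProbabilityMeasure_centeredColumnLaw (hq : 0 < q) :
    IsProbabilityMeasure (centeredColumnLaw q R) :=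
  have := isProbabilityMeasure_noncycleLaw hq
  Measure.isProbabilityMeasure_map Measurable.of_discrete.aemeasurable

theorem memLp_centeredColumnLaw (hq : 0 < q) : MemLp id 2 (centeredColumnLaw q R) :=
  have := isProbabilityMeasure_noncycleLaw hq
  (memLp_map_measure_iff (by fun_prop) Measurable.of_discrete.aemeasurable).2
    (memLp_of_finite _ _ _)

theorem integral_centeredColumnLaw (hq : 2 < q) (hR : AdmissibleScales q N R) :
    ∫ x, x ∂(centeredColumnLaw q R) = 0 := by
  have := isProbabilityMeasure_noncycleLaw (q := q) (by omega)
  rw [centeredColumnLaw, integral_map Measurable.of_discrete.aemeasurable (by fun_prop)]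
  ext i
  have h := ContinuousLinearMap.integral_comp_comm (EuclideanSpace.proj (𝕜 := ℝ) i)
    (memLp_one_iff_integrable.1 (memLp_of_finite (noncycleLaw q)
      (fun B => centeredColumn (pFl q) (column q R B)) 1))
  refine h.symm.trans ?_
  change ∫ B, (pFl q - (column q R B i : ℝ)) ∂(noncycleLaw q) = 0
  rw [integral_sub (integrable_const _) (memLp_one_iff_integrable.1 (memLp_of_finite _ _ _)),
    integral_column, noncycleLaw_real_liftedCycle hq (hR.coprime i)]
  simp

theorem variance_inner_centeredColumnLaw (hq : 2 < q) (hR : AdmissibleScales q N R)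
    (t : EuclideanSpace ℝ (Fin N)) :
    Var[fun x => ⟪x, t⟫; centeredColumnLaw q R] = t ⬝ᵥ (covMatrix N (pFl q)).mulVec t := by
  have := isProbabilityMeasure_noncycleLaw (q := q) (by omega)
  have hI : ∀ f : Chain q → ℝ, Integrable f (noncycleLaw q) := fun f =>
    memLp_one_iff_integrable.1 (memLp_of_finite _ _ _)
  rw [centeredColumnLaw, variance_map (by fun_prop) Measurable.of_discrete.aemeasurable]
  have e : ((fun x => ⟪x, t⟫) ∘ fun B => centeredColumn (pFl q) (column q R B)) =
      fun B => ∑ i, t i * (pFl q - (column q R B i : ℝ)) := by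
    ext B
    simp [PiLp.inner_apply, centeredColumn]
  rw [e, variance_fun_sum' fun i _ => memLp_of_finite _ _ _]
  simp only [dotProduct, Matrix.mulVec, Finset.mul_sum]
  refine Finset.sum_congr rfl fun i _ => Finset.sum_congr rfl fun j _ => ?_
  rw [covariance_const_mul_left, covariance_const_mul_right, covariance_const_sub_left (hI _),
    covariance_const_sub_right (hI _), covariance_column hq hR]
  ring

end

/-! ### The expected minimal row sum -/

/-- Converts the minimum into a maximum. The sign is absorbed into `W`, so no symmetry of the
Gaussian limit is needed later. -/
theorem natCast_iInf_eq_sub_mul_iSup {ι : Type*} [Finite ι] [Nonempty ι] (s : ι → ℕ) (a b : ℝ)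
    (hb : 0 ≤ b) (W : ι → ℝ) (h : ∀ i, (s i : ℝ) = a - b * W i) :
    ((⨅ i, s i : ℕ) : ℝ) = a - b * ⨆ i, W i := by
  obtain ⟨i, hi⟩ := exists_eq_ciInf_of_finite (f := s)
  obtain ⟨k, hk⟩ := exists_eq_ciSup_of_finite (f := W)
  apply le_antisymm
  · rw [← hk, ← h]
    exact_mod_cast ciInf_le (OrderBot.bddBelow _) k
  · rw [← hi, h]
    have := le_ciSup (Set.finite_range W).bddAbove i
    nlinarith

theorem column_eq_of_initialCycle {q N : ℕ} {R : Fin N → ℕ} (hq : 2 < q)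
    (hR : AdmissibleScales q N R) {B : Chain q} (hB : InitialCycle q B) (i j : Fin N) :
    column q R B i = column q R B j := by
  simp only [column, liftedCycle_iff_of_initialCycle hq (hR.coprime _) hB]

namespace IndependenceModel

variable {q N x y : ℕ} {R : Fin N → ℕ} {Ω : Type*} [MeasurableSpace Ω] {P : Measure Ω}
  {A : Fin x ⊕ Fin y → Ω → Chain q}

/-- All random quantities are functions on a finite set of chain configurations, so integrability is
automatic. -/
theorem integrable_comp [IsProbabilityMeasure P] (h : IndependenceModel q R x y P A)
    (f : (Fin x ⊕ Fin y → Chain q) → ℝ) :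
    Integrable (fun ω => f fun j => A j ω) P := by
  have hm : Measurable fun ω j => A j ω := measurable_pi_iff.2 h.measurable
  have : IsProbabilityMeasure (P.map fun ω j => A j ω) :=
    Measure.isProbabilityMeasure_map hm.aemeasurable
  exact (memLp_one_iff_integrable.1
    (memLp_of_finite (P.map fun ω j => A j ω) f 1)).comp_measurable hm

theorem ae_initialCycle (h : IndependenceModel q R x y P A) :
    ∀ᵐ ω ∂P, ∀ j : Fin x, InitialCycle q (A (Sum.inl j) ω) := by
  refine ae_all_iff.2 fun j => ?_
  have hae : ∀ᵐ B ∂(cycleLaw q), B ∈ {B | InitialCycle q B} :=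
    ae_cond_mem (Set.toFinite _).measurableSet
  rw [cycleLaw, ← h.law_cycle j] at hae
  exact ae_of_ae_map (h.measurable _).aemeasurable hae

theorem integral_column_inl (h : IndependenceModel q R x y P A) (hq : 2 < q)
    (hR : AdmissibleScales q N R) (j : Fin x) (i : Fin N) :
    ∫ ω, (column q R (A (Sum.inl j) ω) i : ℝ) ∂P = 3 / 4 := by
  rw [← cycleLaw_real_liftedCycle hq (hR.coprime i), ← integral_column, cycleLaw, ← h.law_cycle j,
    integral_map (h.measurable _).aemeasurable
      StronglyMeasurable.of_discrete.aestronglyMeasurable]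

theorem map_centeredColumn (h : IndependenceModel q R x y P A) (j : Fin y) :
    P.map (fun ω => centeredColumn (pFl q) (column q R (A (Sum.inr j) ω))) =
      centeredColumnLaw q R := by
  rw [centeredColumnLaw, noncycleLaw, ← h.law_noncycle j,
    Measure.map_map Measurable.of_discrete (h.measurable _)]
  rfl

theorem iIndepFun_centeredColumn (h : IndependenceModel q R x y P A) :
    iIndepFun (fun (j : Fin y) ω => centeredColumn (pFl q) (column q R (A (Sum.inr j) ω))) P :=
  (h.indep_columns.precomp Sum.inr_injective).comp (fun _ => centeredColumn (pFl q))
    fun _ => Measurable.of_discrete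

theorem integral_numCycles [NeZero N] [IsProbabilityMeasure P]
    (h : IndependenceModel q R x y P A) (hq : 2 < q) (hR : AdmissibleScales q N R) (hy : 0 < y) :
    ∫ ω, (numCycles q R (fun j => A j ω) : ℝ) ∂P = 3 / 4 * (x : ℝ) + pFl q * (y : ℝ) -
      Real.sqrt y * ∫ ω, ⨆ i, ((Real.sqrt y)⁻¹ • ∑ j : Fin y,
        centeredColumn (pFl q) (column q R (A (Sum.inr j) ω))) i ∂P := by
  have hs : Real.sqrt y ≠ 0 := (Real.sqrt_pos.2 (by exact_mod_cast hy)).ne'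
  let f : (Fin x ⊕ Fin y → Chain q) → ℝ := fun B => ⨆ i, ((Real.sqrt y)⁻¹ • ∑ j : Fin y,
    centeredColumn (pFl q) (column q R (B (Sum.inr j)))) i
  -- Almost surely the initial cycles contribute equally to all rows, so their contribution can be
  -- read off in row 0 and pulled out of the minimum.
  have hae : ∀ᵐ ω ∂P, (numCycles q R (fun j => A j ω) : ℝ) =
      ((∑ j : Fin x, (column q R (A (Sum.inl j) ω) 0 : ℝ)) + pFl q * y) -
        Real.sqrt y * f fun j => A j ω := by
    filter_upwards [h.ae_initialCycle] with ω hω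
    apply natCast_iInf_eq_sub_mul_iSup _ _ _ (Real.sqrt_nonneg _)
    intro i
    simp only [Fintype.sum_sum_type, column_eq_of_initialCycle hq hR (hω _) i 0]
    simp only [PiLp.smul_apply, smul_eq_mul, mul_inv_cancel_left₀ hs, WithLp.ofLp_sum,
      Finset.sum_apply, centeredColumn, Finset.sum_sub_distrib]
    simp
    ring
  rw [integral_congr_ae hae, integral_sub, integral_add, integral_finsetSum,
    integral_const_mul (Real.sqrt y)]
  · simp only [h.integral_column_inl hq hR, f]
    simp
    ring
  · exact fun j _ => h.integrable_comp fun B => (column q R (B (Sum.inl j)) 0 : ℝ)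
  · exact h.integrable_comp fun B => ∑ j : Fin x, (column q R (B (Sum.inl j)) 0 : ℝ)
  · exact integrable_const _
  · exact h.integrable_comp fun B =>
      (∑ j : Fin x, (column q R (B (Sum.inl j)) 0 : ℝ)) + pFl q * y
  · exact (h.integrable_comp f).const_mul _

end IndependenceModel

end QCLDPC

theorem mainTheorem6 (q : ℕ) (hq : 2 < q) (N : ℕ) (hN : 0 < N) (r : Fin N → ℕ)
    (hr : QCLDPC.AdmissibleScales q N r)
    (x : ℕ → ℕ) (Ω : ℕ → Type*) [∀ y, MeasurableSpace (Ω y)]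
    (P : ∀ y, Measure (Ω y)) [∀ y, IsProbabilityMeasure (P y)]
    (A : ∀ y, Fin (x y) ⊕ Fin y → Ω y → QCLDPC.Chain q)
    (hA : ∀ y, QCLDPC.IndependenceModel q r (x y) y (P y) (A y)) :
    (fun y : ℕ => (∫ ω, (QCLDPC.numCycles q r (fun j => A y j ω) : ℝ) ∂(P y)) -
        (3 / 4 * (x y : ℝ) + QCLDPC.pFl q * (y : ℝ) -
          QCLDPC.gaussianMax N (QCLDPC.covMatrix N (QCLDPC.pFl q)) * Real.sqrt (y : ℝ)))
      =o[atTop] (fun y : ℕ => Real.sqrt (y : ℝ)) := by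
  have : NeZero N := ⟨hN.ne'⟩
  have := QCLDPC.isProbabilityMeasure_centeredColumnLaw (q := q) (R := r) (by omega)
  have hlim := QCLDPC.tendsto_integral_iSup_inv_sqrt_smul_sum P
    (fun y j ω => QCLDPC.centeredColumn (QCLDPC.pFl q) (QCLDPC.column q r (A y (Sum.inr j) ω)))
    (fun y j => (Measurable.of_discrete
      (f := fun B => QCLDPC.centeredColumn (QCLDPC.pFl q) (QCLDPC.column q r B))).comp
        ((hA y).measurable _))
    (fun y => (hA y).iIndepFun_centeredColumn) (QCLDPC.centeredColumnLaw q r)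
    (fun y j => (hA y).map_centeredColumn j) (QCLDPC.memLp_centeredColumnLaw (by omega))
    (QCLDPC.integral_centeredColumnLaw hq hr) (QCLDPC.covMatrix_isSymm N (QCLDPC.pFl q))
    (QCLDPC.variance_inner_centeredColumnLaw hq hr)
  -- For `y > 0` the error is exactly `√y` times this difference, which tends to 0; the terms in `x
  -- y` cancel, so no condition on `x` arises.
  have h0 := (hlim.const_sub (QCLDPC.gaussianMax N (QCLDPC.covMatrix N (QCLDPC.pFl q))))
  rw [sub_self] at h0
  have ho := ((isLittleO_one_iff ℝ).2 h0).mul_isBigO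
    (isBigO_refl (fun y : ℕ => Real.sqrt (y : ℝ)) atTop)
  simp only [one_mul] at ho
  refine ho.congr' ?_ EventuallyEq.rfl
  filter_upwards [eventually_gt_atTop 0] with y hy
  rw [(hA y).integral_numCycles hq hr hy]
  ring
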